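/- Let $n\ge 0$ and let $\sigma$ be a permutation of $[n]=\{1,\dots,n\}$. The number of weak exceedances of $\sigma$ is $\#\{j : \sigma(j)\ge j\}$. The number of crossings of $\sigma$ is $$\#\{(i,j) : j<i\le\sigma(j)<\sigma(i)\}+\#\{(i,j) : j>i>\sigma(j)>\sigma(i)\},$$ and the number of nestings of $\sigma$ is $$\#\{(i,j) : j<i\le\sigma(i)<\sigma(j)\}+\#\{(i,j) : j>i>\sigma(i)>\sigma(j)\}.$$ **Proposition.** For all integers $n,k,\ell,m\ge 0$, the number of permutations of $[n]$ with $k$ weak exceedances, $\ell$ crossings and $m$ nestings equals the number of permutations of $[n]$ with $k$ weak exceedances, $\ell$ nestings and $m$ crossings. -/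

import Mathlib

namespace PermCrossing

/-! Permutations of `[n]` are modelled as `Equiv.Perm (Fin n)`. All the statistics below only
compare positions and values, so they do not depend on whether the labels are `1, …, n` or
`0, …, n - 1`. -/

variable {n : ℕ}

/-- The number of weak exceedances: the number of `j` with `σ j ≥ j`. -/
def wex (σ : Equiv.Perm (Fin n)) : ℕ :=
  (Finset.univ.filter fun j => j ≤ σ j).card

/-- `C₊(i) = {j | j < i ≤ σ j < σ i}`. -/
def upperCrossingSet (σ : Equiv.Perm (Fin n)) (i : Fin n) : Finset (Fin n) :=
  Finset.univ.filter fun j => j < i ∧ i ≤ σ j ∧ σ j < σ i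

/-- `C₋(i) = {j | j > i > σ j > σ i}`. -/
def lowerCrossingSet (σ : Equiv.Perm (Fin n)) (i : Fin n) : Finset (Fin n) :=
  Finset.univ.filter fun j => i < j ∧ σ j < i ∧ σ i < σ j

/-- `A₊(i) = {j | j < i ≤ σ i < σ j}`. -/
def upperNestingSet (σ : Equiv.Perm (Fin n)) (i : Fin n) : Finset (Fin n) :=
  Finset.univ.filter fun j => j < i ∧ i ≤ σ i ∧ σ i < σ j

/-- `A₋(i) = {j | j > i > σ i > σ j}`. -/
def lowerNestingSet (σ : Equiv.Perm (Fin n)) (i : Fin n) : Finset (Fin n) :=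
  Finset.univ.filter fun j => i < j ∧ σ i < i ∧ σ j < σ i

/-- The number of crossings `C₊(σ) + C₋(σ)`. -/
def crossings (σ : Equiv.Perm (Fin n)) : ℕ :=
  (∑ i, (upperCrossingSet σ i).card) + ∑ i, (lowerCrossingSet σ i).card

/-- The number of nestings `A₊(σ) + A₋(σ)`. -/
def nestings (σ : Equiv.Perm (Fin n)) : ℕ :=
  (∑ i, (upperNestingSet σ i).card) + ∑ i, (lowerNestingSet σ i).card

end PermCrossing

/-! Split `σ` into its weak exceedances and the remaining positions; no crossing or nesting mixes
the two. Each half is a matching from a set `W` to a set `V`, the second one with both orders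
reversed. In a matching, the crossings and the nestings at `i` have a sum that depends only on `W`,
`V` and `i` (`IsMatching.belowCount_add_aboveCount`). The crossing numbers form a code that
determines the matching, and every code within the bounds occurs. Hence the two statistics can be
exchanged at every position with `W` and `V` fixed. The resulting companion is unique, so taking
companions is an involution. -/

namespace PermCrossing

/-! ### Matchings and their codes -/

section Matching

section Bijection

variable {α β : Type*} {R : α → β → Prop} {W : Finset α} {V : Finset β} {f : α → β}

/-- `f` restricts to a bijection from `W` to `V` whose graph is contained in `R`. -/
def IsMatching (R : α → β → Prop) (W : Finset α) (V : Finset β) (f : α → β) : Prop :=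
  Set.BijOn f W V ∧ ∀ i ∈ W, R i (f i)

theorem IsMatching.image_filter [DecidableEq β] (hf : IsMatching R W V f) (p : β → Prop)
    [DecidablePred p] : (W.filter fun j => p (f j)).image f = V.filter p := by
  ext v
  simp only [Finset.mem_image, Finset.mem_filter]
  constructor
  · rintro ⟨j, ⟨hj, hp⟩, rfl⟩
    exact ⟨hf.1.mapsTo hj, hp⟩
  · rintro ⟨hv, hp⟩
    obtain ⟨j, hj, rfl⟩ := hf.1.surjOn hv
    exact ⟨j, ⟨hj, hp⟩, rfl⟩

theorem IsMatching.card_filter (hf : IsMatching R W V f) (p : β → Prop) [DecidablePred p] :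
    (W.filter fun j => p (f j)).card = (V.filter p).card := by
  classical
  rw [← hf.image_filter p, Finset.card_image_of_injOn]
  exact hf.1.injOn.mono (Finset.coe_subset.2 (Finset.filter_subset _ _))

end Bijection

variable {α β : Type*} [LinearOrder α] [LinearOrder β]

open scoped Classical in
/-- The number of `j < i` in `W` whose image under `f` is admissible for `i` and below `f i`. -/
noncomputable def belowCount (R : α → β → Prop) (W : Finset α) (f : α → β) (i : α) : ℕ :=
  (W.filter fun j => j < i ∧ R i (f j) ∧ f j < f i).card

open scoped Classical in
/-- The number of `j < i` in `W` whose image under `f` is above `f i`. -/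
noncomputable def aboveCount (W : Finset α) (f : α → β) (i : α) : ℕ :=
  (W.filter fun j => j < i ∧ f i < f j).card

variable {R : α → β → Prop} {W : Finset α} {V : Finset β} {f g : α → β}

-- Sort the values admissible for `i` by their preimages `j`. By `hR`, those with `j ≥ i` are all
-- admissible, as are those with `f j > f i`; the `1` counts `j = i`.
open scoped Classical in
theorem IsMatching.belowCount_add_aboveCount
    (hR : ∀ ⦃i i' v v'⦄, i ≤ i' → v ≤ v' → R i' v → R i v')
    (hf : IsMatching R W V f) {i : α} (hi : i ∈ W) :
    belowCount R W f i + aboveCount W f i + ((W.filter fun j => i < j).card + 1) =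
      (V.filter fun v => R i v).card := by
  have hne : ∀ j ∈ W, f j = f i → j = i := fun j hj h => hf.1.injOn hj hi h
  rw [← hf.card_filter, belowCount, aboveCount]
  have h1 : ((W.filter fun j => i < j).card + 1) = (W.filter fun j => i ≤ j).card := by
    rw [← Finset.card_insert_of_notMem (a := i) (by simp)]
    congr 1
    ext j
    simp only [Finset.mem_insert, Finset.mem_filter]
    constructor
    · rintro (rfl | h)
      · exact ⟨hi, le_rfl⟩
      · exact ⟨h.1, h.2.le⟩
    · rintro ⟨h, h'⟩
      rcases h'.eq_or_lt with rfl | h'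
      · exact Or.inl rfl
      · exact Or.inr ⟨h, h'⟩
  rw [h1, ← Finset.card_union_of_disjoint, ← Finset.card_union_of_disjoint]
  · congr 1
    ext j
    simp only [Finset.mem_union, Finset.mem_filter]
    constructor
    · rintro ((⟨h, -, h', -⟩ | ⟨h, -, h'⟩) | ⟨h, h'⟩)
      · exact ⟨h, h'⟩
      · exact ⟨h, hR le_rfl h'.le (hf.2 i hi)⟩
      · exact ⟨h, hR h' le_rfl (hf.2 j h)⟩
    · rintro ⟨h, h'⟩
      rcases lt_or_ge j i with hji | hij
      · rcases lt_trichotomy (f j) (f i) with h2 | h2 | h2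
        · exact Or.inl (Or.inl ⟨h, hji, h', h2⟩)
        · exact absurd (hne j h h2) hji.ne
        · exact Or.inl (Or.inr ⟨h, hji, h2⟩)
      · exact Or.inr ⟨h, hij⟩
  · rw [Finset.disjoint_left]
    intro j hj hj'
    simp only [Finset.mem_union, Finset.mem_filter] at hj hj'
    rcases hj with hj | hj
    · exact absurd hj'.2 hj.2.1.not_ge
    · exact absurd hj'.2 hj.2.1.not_ge
  · rw [Finset.disjoint_left]
    intro j hj hj'
    simp only [Finset.mem_filter] at hj hj'
    exact lt_asymm hj.2.2.2 hj'.2.2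

open scoped Classical in
/-- The values below `f i` that are admissible for `i` and not taken by any `j > i`. -/
theorem IsMatching.belowCount_eq (hf : IsMatching R W V f) {i : α} :
    belowCount R W f i =
      (V.filter fun v => R i v ∧ v < f i ∧ ∀ j ∈ W, i < j → f j ≠ v).card := by
  rw [← hf.card_filter, belowCount]
  congr 1
  ext j
  simp only [Finset.mem_filter]
  constructor
  · rintro ⟨h, h1, h2, h3⟩
    refine ⟨h, h2, h3, fun k hk hik hkj => ?_⟩
    rw [hf.1.injOn hk h hkj] at hik
    exact lt_asymm h1 hik
  · rintro ⟨h, h2, h3, h4⟩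
    refine ⟨h, ?_, h2, h3⟩
    rcases lt_trichotomy j i with h5 | h5 | h5
    · exact h5
    · exact absurd h3 (by simp [h5])
    · exact absurd rfl (h4 j h h5)

/-- If `f i < g i`, every value counted for `f` is counted for `g`, and `f i` is counted for `g`
only. -/
theorem IsMatching.not_lt_of_belowCount_eq (hf : IsMatching R W V f) (hg : IsMatching R W V g)
    {i : α} (hi : i ∈ W) (h : belowCount R W f i = belowCount R W g i)
    (hmax : ∀ j ∈ W, i < j → f j = g j) : ¬ f i < g i := by
  classical
  intro hlt
  refine h.not_lt ?_
  rw [hf.belowCount_eq, hg.belowCount_eq]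
  refine Finset.card_lt_card (Finset.ssubset_iff_of_subset ?_ |>.2 ⟨f i, ?_, ?_⟩)
  · intro v
    simp only [Finset.mem_filter]
    rintro ⟨hv, h1, h2, h3⟩
    exact ⟨hv, h1, h2.trans hlt, fun j hj hij => hmax j hj hij ▸ h3 j hj hij⟩
  · simp only [Finset.mem_filter]
    refine ⟨hf.1.mapsTo hi, hf.2 i hi, hlt, fun j hj hij hji => hij.ne' ?_⟩
    rw [← hmax j hj hij] at hji
    exact hf.1.injOn hj hi hji
  · simp

/-- A matching is determined by its `belowCount` statistics. -/
theorem IsMatching.eqOn_of_belowCount_eq (hf : IsMatching R W V f) (hg : IsMatching R W V g)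
    (h : ∀ i ∈ W, belowCount R W f i = belowCount R W g i) : ∀ i ∈ W, f i = g i := by
  classical
  by_contra! hne
  obtain ⟨i₀, hi₀, hne₀⟩ := hne
  obtain ⟨i, hi, hmax⟩ := (W.filter fun i => f i ≠ g i).exists_max_image id
    ⟨i₀, Finset.mem_filter.2 ⟨hi₀, hne₀⟩⟩
  rw [Finset.mem_filter] at hi
  have hagree : ∀ j ∈ W, i < j → f j = g j := by
    intro j hj hij
    by_contra hc
    exact (hmax j (Finset.mem_filter.2 ⟨hj, hc⟩)).not_gt hij
  rcases lt_or_gt_of_ne hi.2 with hlt | hlt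
  · exact hf.not_lt_of_belowCount_eq hg hi.1 (h i hi.1) hagree hlt
  · exact hg.not_lt_of_belowCount_eq hf hi.1 (h i hi.1).symm
      (fun j hj hij => (hagree j hj hij).symm) hlt

theorem exists_mem_card_filter_lt_eq (B : Finset β) {c : ℕ} (hc : c < B.card) :
    ∃ v ∈ B, (B.filter fun u => u < v).card = c := by
  refine ⟨B.orderEmbOfFin rfl ⟨c, hc⟩, B.orderEmbOfFin_mem rfl _, ?_⟩
  have : (B.filter fun u => u < B.orderEmbOfFin rfl ⟨c, hc⟩) =
      (Finset.Iio (⟨c, hc⟩ : Fin B.card)).map (B.orderEmbOfFin rfl).toEmbedding := by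
    ext u
    simp only [Finset.mem_filter, Finset.mem_map, Finset.mem_Iio]
    constructor
    · rintro ⟨hu, hlt⟩
      have hu' : u ∈ Set.range (B.orderEmbOfFin rfl) := by
        rw [Finset.range_orderEmbOfFin]; exact hu
      obtain ⟨k, rfl⟩ := hu'
      exact ⟨k, (B.orderEmbOfFin rfl).lt_iff_lt.1 hlt, rfl⟩
    · rintro ⟨k, hk, rfl⟩
      exact ⟨B.orderEmbOfFin_mem rfl _, (B.orderEmbOfFin rfl).lt_iff_lt.2 hk⟩
  rw [this, Finset.card_map, Fin.card_Iio]

open scoped Classical in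
/-- Every sufficiently small code is the `belowCount` statistic of some matching. -/
theorem exists_isMatching_belowCount_eq [Nonempty β]
    (hR : ∀ ⦃i i' v v'⦄, i ≤ i' → v ≤ v' → R i' v → R i v') (c : α → ℕ) (W : Finset α) :
    ∀ V : Finset β, V.card = W.card →
      (∀ i ∈ W, c i + (W.filter fun j => i < j).card < (V.filter fun v => R i v).card) →
      ∃ f : α → β, IsMatching R W V f ∧ ∀ i ∈ W, belowCount R W f i = c i := by
  induction W using Finset.induction_on_max with
  | empty =>
    intro V hV _
    rw [Finset.card_empty, Finset.card_eq_zero] at hV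
    subst hV
    exact ⟨fun _ => Classical.arbitrary β, ⟨by simp, by simp⟩, by simp⟩
  | insert a W ha ih =>
    intro V hV hc
    have haW : a ∉ W := fun h => lt_irrefl _ (ha a h)
    rw [Finset.card_insert_of_notMem haW] at hV
    -- As `a` is the largest position, all other values have preimages below `a`, so its count is
    -- just the rank of `v` among the values admissible for `a`.
    obtain ⟨v, hv, hvc⟩ := exists_mem_card_filter_lt_eq (V.filter fun v => R a v) (c := c a)
      ((Nat.le_add_right _ _).trans_lt (hc a (Finset.mem_insert_self _ _)))
    rw [Finset.mem_filter] at hv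
    obtain ⟨f, hf, hfc⟩ := ih (V.erase v) (by rw [Finset.card_erase_of_mem hv.1, hV]; rfl) (by
      intro i hi
      have h1 := hc i (Finset.mem_insert_of_mem hi)
      rw [Finset.filter_insert, if_pos (ha i hi),
        Finset.card_insert_of_notMem (by simp [haW])] at h1
      -- By `hR`, `v` is admissible for every `i < a`: one admissible value is lost together with
      -- one later position, and the bound persists.
      have h2 : ((V.erase v).filter fun u => R i u).card =
          (V.filter fun u => R i u).card - 1 := by
        rw [Finset.filter_erase, Finset.card_erase_of_mem
          (Finset.mem_filter.2 ⟨hv.1, hR (ha i hi).le le_rfl hv.2⟩)]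
      omega)
    have hup : ∀ i ∈ W, Function.update f a v i = f i := fun i hi =>
      Function.update_of_ne (ha i hi).ne _ _
    refine ⟨Function.update f a v, ⟨?_, ?_⟩, ?_⟩
    · have h1 : Set.BijOn (Function.update f a v) W (V.erase v) :=
        hf.1.congr fun i hi => (hup i hi).symm
      have h2 := h1.insert (a := a) (by simp)
      rw [Function.update_self] at h2
      rwa [← Finset.coe_insert, ← Finset.coe_insert, Finset.insert_erase hv.1] at h2
    · intro i hi
      rcases Finset.mem_insert.1 hi with rfl | hi
      · rw [Function.update_self]; exact hv.2
      · rw [hup i hi]; exact hf.2 i hi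
    · intro i hi
      rcases Finset.mem_insert.1 hi with rfl | hi
      · rw [← hvc, Finset.filter_filter, belowCount, Function.update_self]
        have h3 : (W.filter fun j => R i (f j) ∧ f j < v).card =
            ((V.erase v).filter fun u => R i u ∧ u < v).card :=
          hf.card_filter fun u => R i u ∧ u < v
        rw [Finset.filter_erase, Finset.erase_eq_of_notMem (by simp)] at h3
        rw [← h3, Finset.filter_insert, if_neg (by simp)]
        congr 1
        refine Finset.filter_congr fun j hj => ?_
        rw [hup j hj]
        simp [ha j hj]
      · rw [← hfc i hi, belowCount, belowCount, Finset.filter_insert,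
          if_neg (fun h => lt_asymm h.1 (ha i hi)), hup i hi]
        congr 1
        exact Finset.filter_congr fun j hj => by rw [hup j hj]

theorem card_eq_belowCount {S : Finset α} {i : α}
    (h : ∀ j, j ∈ S ↔ j ∈ W ∧ j < i ∧ R i (f j) ∧ f j < f i) : S.card = belowCount R W f i := by
  classical
  rw [belowCount]
  congr 1
  ext j
  rw [h j, Finset.mem_filter]

theorem card_eq_aboveCount {S : Finset α} {i : α}
    (h : ∀ j, j ∈ S ↔ j ∈ W ∧ j < i ∧ f i < f j) : S.card = aboveCount W f i := by
  rw [aboveCount]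
  congr 1
  ext j
  rw [h j, Finset.mem_filter]

/-- Every matching has a companion in which `belowCount` and `aboveCount` are exchanged. -/
theorem IsMatching.exists_swap (hR : ∀ ⦃i i' v v'⦄, i ≤ i' → v ≤ v' → R i' v → R i v')
    (hf : IsMatching R W V f) :
    ∃ g : α → β, IsMatching R W V g ∧
      ∀ i ∈ W, belowCount R W g i = aboveCount W f i ∧ aboveCount W g i = belowCount R W f i := by
  classical
  rcases isEmpty_or_nonempty β with hβ | hβ
  · exact ⟨f, hf, fun i => hβ.elim (f i)⟩
  obtain ⟨g, hg, hgc⟩ := exists_isMatching_belowCount_eq hR (aboveCount W f) W V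
    (by simpa using (hf.card_filter fun _ => True).symm) (by
      intro i hi
      have := hf.belowCount_add_aboveCount hR hi
      -- The `1` in the identity makes the required bound strict.
      omega)
  refine ⟨g, hg, fun i hi => ⟨hgc i hi, ?_⟩⟩
  have h1 := hf.belowCount_add_aboveCount hR hi
  have h2 := hg.belowCount_add_aboveCount hR hi
  have h3 := hgc i hi
  omega

end Matching

/-! ### The two matchings of a permutation -/

variable {n : ℕ}

/-- The positions of the weak exceedances. -/
def wexSet (σ : Equiv.Perm (Fin n)) : Finset (Fin n) :=
  Finset.univ.filter fun j => j ≤ σ j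

theorem mem_wexSet {σ : Equiv.Perm (Fin n)} {i : Fin n} : i ∈ wexSet σ ↔ i ≤ σ i := by
  simp [wexSet]

/-- The values taken at the weak exceedances. -/
def wexValues (σ : Equiv.Perm (Fin n)) : Finset (Fin n) :=
  (wexSet σ).image σ

theorem isMatching_upper (σ : Equiv.Perm (Fin n)) :
    IsMatching (fun i v : Fin n => i ≤ v) (wexSet σ) (wexValues σ) σ := by
  refine ⟨?_, fun i hi => mem_wexSet.1 hi⟩
  rw [wexValues, Finset.coe_image]
  exact σ.injective.injOn.bijOn_image

/-- In the dual orders `i < v` means that the value lies strictly below the position; fixed points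
belong to the upper half. -/
theorem isMatching_lower (σ : Equiv.Perm (Fin n)) :
    IsMatching (α := (Fin n)ᵒᵈ) (β := (Fin n)ᵒᵈ) (fun i v => i < v)
      (wexSet σ)ᶜ (wexValues σ)ᶜ σ := by
  refine ⟨?_, fun i hi => ?_⟩
  · have h : (((wexValues σ)ᶜ : Finset (Fin n)) : Set (Fin n)) =
        σ '' ((wexSet σ)ᶜ : Finset (Fin n)) := by
      rw [wexValues, Finset.coe_compl, Finset.coe_image, Finset.coe_compl,
        Set.image_compl_eq σ.bijective]
    have h2 : Set.BijOn σ ((wexSet σ)ᶜ : Finset (Fin n)) ((wexValues σ)ᶜ : Finset (Fin n)) := by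
      rw [h]
      exact σ.injective.injOn.bijOn_image
    exact h2
  · have h : i ∉ wexSet σ := Finset.mem_compl.1 hi
    exact lt_of_not_ge fun h' => h (mem_wexSet.2 h')

theorem card_upperCrossingSet (σ : Equiv.Perm (Fin n)) (i : Fin n) :
    (upperCrossingSet σ i).card = belowCount (fun i v : Fin n => i ≤ v) (wexSet σ) σ i := by
  refine card_eq_belowCount fun j => ?_
  simp only [upperCrossingSet, Finset.mem_filter, Finset.mem_univ, true_and, mem_wexSet]
  exact ⟨fun h => ⟨h.1.le.trans h.2.1, h⟩, And.right⟩

/-- Unlike `belowCount`, `aboveCount` does not test admissibility at `i`, hence `hi`. -/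
theorem card_upperNestingSet (σ : Equiv.Perm (Fin n)) {i : Fin n} (hi : i ∈ wexSet σ) :
    (upperNestingSet σ i).card = aboveCount (wexSet σ) σ i := by
  rw [mem_wexSet] at hi
  refine card_eq_aboveCount fun j => ?_
  simp only [upperNestingSet, Finset.mem_filter, Finset.mem_univ, true_and, mem_wexSet]
  exact ⟨fun h => ⟨(h.1.le.trans h.2.1).trans h.2.2.le, h.1, h.2.2⟩,
    fun h => ⟨h.2.1, hi, h.2.2⟩⟩

theorem mem_lowerCrossingSet {σ : Equiv.Perm (Fin n)} {i j : Fin n} :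
    j ∈ lowerCrossingSet σ i ↔ i < j ∧ σ j < i ∧ σ i < σ j := by
  simp [lowerCrossingSet]

theorem mem_lowerNestingSet {σ : Equiv.Perm (Fin n)} {i j : Fin n} :
    j ∈ lowerNestingSet σ i ↔ i < j ∧ σ i < i ∧ σ j < σ i := by
  simp [lowerNestingSet]

theorem card_lowerCrossingSet (σ : Equiv.Perm (Fin n)) (i : Fin n) :
    (lowerCrossingSet σ i).card =
      belowCount (α := (Fin n)ᵒᵈ) (β := (Fin n)ᵒᵈ) (fun i v => i < v) (wexSet σ)ᶜ σ i := by
  refine card_eq_belowCount (α := (Fin n)ᵒᵈ) (β := (Fin n)ᵒᵈ) fun j => mem_lowerCrossingSet.trans ?_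
  refine ⟨fun h => ⟨Finset.mem_compl.2 fun hj => ?_, h⟩, fun h => h.2⟩
  exact (mem_wexSet.1 hj).not_gt (h.2.1.trans h.1)

theorem card_lowerNestingSet (σ : Equiv.Perm (Fin n)) {i : Fin n} (hi : i ∉ wexSet σ) :
    (lowerNestingSet σ i).card =
      aboveCount (α := (Fin n)ᵒᵈ) (β := (Fin n)ᵒᵈ) (wexSet σ)ᶜ σ i := by
  rw [mem_wexSet, not_le] at hi
  refine card_eq_aboveCount (α := (Fin n)ᵒᵈ) (β := (Fin n)ᵒᵈ) fun j => mem_lowerNestingSet.trans ?_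
  refine ⟨fun h => ⟨Finset.mem_compl.2 fun hj => ?_, h.1, h.2.2⟩,
    fun h => ⟨h.2.1, hi, h.2.2⟩⟩
  exact (mem_wexSet.1 hj).not_gt (h.2.2.trans (h.2.1.trans h.1))

theorem upperCrossingSet_eq_empty {σ : Equiv.Perm (Fin n)} {i : Fin n} (hi : i ∉ wexSet σ) :
    upperCrossingSet σ i = ∅ :=
  Finset.filter_eq_empty_iff.2 fun _ _ h => hi (mem_wexSet.2 (h.2.1.trans h.2.2.le))

theorem upperNestingSet_eq_empty {σ : Equiv.Perm (Fin n)} {i : Fin n} (hi : i ∉ wexSet σ) :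
    upperNestingSet σ i = ∅ :=
  Finset.filter_eq_empty_iff.2 fun _ _ h => hi (mem_wexSet.2 h.2.1)

theorem lowerCrossingSet_eq_empty {σ : Equiv.Perm (Fin n)} {i : Fin n} (hi : i ∈ wexSet σ) :
    lowerCrossingSet σ i = ∅ :=
  Finset.filter_eq_empty_iff.2 fun _ _ h => (mem_wexSet.1 hi).not_gt (h.2.2.trans h.2.1)

theorem lowerNestingSet_eq_empty {σ : Equiv.Perm (Fin n)} {i : Fin n} (hi : i ∈ wexSet σ) :
    lowerNestingSet σ i = ∅ :=
  Finset.filter_eq_empty_iff.2 fun _ _ h => (mem_wexSet.1 hi).not_gt h.2.1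

/-! ### The companion involution -/

/-- `τ` has the weak exceedances of `σ`, with the same set of values, and at every position the
crossings of `τ` are as many as the nestings of `σ` and conversely. -/
structure IsCompanion (σ τ : Equiv.Perm (Fin n)) : Prop where
  wexSet_eq : wexSet τ = wexSet σ
  wexValues_eq : wexValues τ = wexValues σ
  upperCrossing : ∀ i, (upperCrossingSet τ i).card = (upperNestingSet σ i).card
  upperNesting : ∀ i, (upperNestingSet τ i).card = (upperCrossingSet σ i).card
  lowerCrossing : ∀ i, (lowerCrossingSet τ i).card = (lowerNestingSet σ i).card
  lowerNesting : ∀ i, (lowerNestingSet τ i).card = (lowerCrossingSet σ i).card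

theorem IsCompanion.symm {σ τ : Equiv.Perm (Fin n)} (h : IsCompanion σ τ) : IsCompanion τ σ :=
  ⟨h.1.symm, h.2.symm, fun i => (h.4 i).symm, fun i => (h.3 i).symm, fun i => (h.6 i).symm,
    fun i => (h.5 i).symm⟩

/-- Both halves of a companion have prescribed positions, values and codes. -/
theorem IsCompanion.eq {σ τ τ' : Equiv.Perm (Fin n)} (h : IsCompanion σ τ)
    (h' : IsCompanion σ τ') : τ = τ' := by
  have hW : wexSet τ = wexSet τ' := h.1.trans h'.1.symm
  have hV : wexValues τ = wexValues τ' := h.2.trans h'.2.symm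
  have hu' := isMatching_upper τ'
  have hl' := isMatching_lower τ'
  rw [← hW, ← hV] at hu' hl'
  refine Equiv.ext fun i => ?_
  by_cases hi : i ∈ wexSet τ
  · refine (isMatching_upper τ).eqOn_of_belowCount_eq hu' (fun k _ => ?_) i hi
    rw [← card_upperCrossingSet, hW, ← card_upperCrossingSet, h.3, h'.3]
  · refine (isMatching_lower τ).eqOn_of_belowCount_eq hl' (fun k _ => ?_) i
      (Finset.mem_compl.2 hi)
    have h1 := card_lowerCrossingSet τ' k
    rw [← hW] at h1
    exact (card_lowerCrossingSet τ k).symm.trans ((h.5 k).trans ((h'.5 k).symm.trans h1))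

theorem belowCount_congr {α β : Type*} [LinearOrder α] [LinearOrder β] {R : α → β → Prop}
    {W : Finset α} {f g : α → β} (h : ∀ i ∈ W, f i = g i) {i : α} (hi : i ∈ W) :
    belowCount R W f i = belowCount R W g i := by
  classical
  rw [belowCount, belowCount]
  congr 1
  exact Finset.filter_congr fun j hj => by rw [h i hi, h j hj]

theorem aboveCount_congr {α β : Type*} [LinearOrder α] [LinearOrder β]
    {W : Finset α} {f g : α → β} (h : ∀ i ∈ W, f i = g i) {i : α} (hi : i ∈ W) :
    aboveCount W f i = aboveCount W g i := by
  classical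
  rw [aboveCount, aboveCount]
  congr 1
  exact Finset.filter_congr fun j hj => by rw [h i hi, h j hj]

theorem exists_isCompanion (σ : Equiv.Perm (Fin n)) : ∃ τ, IsCompanion σ τ := by
  obtain ⟨f, hf, hfc⟩ := (isMatching_upper σ).exists_swap
    (fun i i' v v' h1 h2 h3 => h1.trans (h3.trans h2))
  obtain ⟨g, hg, hgc⟩ := (isMatching_lower σ).exists_swap
    (fun i i' v v' h1 h2 h3 => h1.trans_lt (h3.trans_le h2))
  -- The swapped halves have complementary images, so they glue to a permutation.
  let t : Fin n → Fin n := fun i => if i ∈ wexSet σ then f i else g i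
  have htf : ∀ i ∈ wexSet σ, t i = f i := fun i hi => if_pos hi
  have htg : ∀ i ∈ (wexSet σ)ᶜ, t i = g i := fun i hi => if_neg (Finset.mem_compl.1 hi)
  have himage : (wexSet σ).image t = wexValues σ := by
    rw [← Finset.coe_inj, Finset.coe_image, Set.image_congr htf, hf.1.image_eq]
  have hsurj : Function.Surjective t := by
    intro v
    by_cases hv : v ∈ wexValues σ
    · obtain ⟨i, hi, rfl⟩ := hf.1.surjOn hv
      exact ⟨i, htf i hi⟩
    · obtain ⟨i, hi, rfl⟩ := hg.1.surjOn (Finset.mem_coe.2 (Finset.mem_compl.2 hv))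
      exact ⟨i, htg i hi⟩
  let τ : Equiv.Perm (Fin n) := Equiv.ofBijective t (Finite.surjective_iff_bijective.1 hsurj)
  have hτf : ∀ i ∈ wexSet σ, τ i = f i := htf
  have hτg : ∀ i ∈ (wexSet σ)ᶜ, τ i = g i := htg
  have hW : wexSet τ = wexSet σ := by
    ext i
    rw [mem_wexSet]
    by_cases hi : i ∈ wexSet σ
    · rw [hτf i hi]
      exact iff_of_true (hf.2 i hi) hi
    · rw [hτg i (Finset.mem_compl.2 hi)]
      exact iff_of_false (not_le_of_gt (α := Fin n) (hg.2 i (Finset.mem_compl.2 hi))) hi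
  refine ⟨τ, hW, ?_, fun i => ?_, fun i => ?_, fun i => ?_, fun i => ?_⟩
  · rw [wexValues, hW]
    exact himage
  · by_cases hi : i ∈ wexSet σ
    · rw [card_upperCrossingSet, hW, card_upperNestingSet σ hi, belowCount_congr hτf hi,
        (hfc i hi).1]
    · rw [upperCrossingSet_eq_empty (hW ▸ hi), upperNestingSet_eq_empty hi]
  · by_cases hi : i ∈ wexSet σ
    · rw [card_upperCrossingSet, card_upperNestingSet τ (hW ▸ hi), hW, aboveCount_congr hτf hi,
        (hfc i hi).2]
    · rw [upperCrossingSet_eq_empty hi, upperNestingSet_eq_empty (hW ▸ hi)]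
  · by_cases hi : i ∈ wexSet σ
    · rw [lowerCrossingSet_eq_empty (hW ▸ hi), lowerNestingSet_eq_empty hi]
    · have hi' := Finset.mem_compl.2 hi
      rw [card_lowerCrossingSet, hW, card_lowerNestingSet σ hi]
      exact (belowCount_congr (α := (Fin n)ᵒᵈ) (β := (Fin n)ᵒᵈ) hτg hi').trans (hgc i hi').1
  · by_cases hi : i ∈ wexSet σ
    · rw [lowerCrossingSet_eq_empty hi, lowerNestingSet_eq_empty (hW ▸ hi)]
    · have hi' := Finset.mem_compl.2 hi
      rw [card_lowerCrossingSet, card_lowerNestingSet τ (hW ▸ hi), hW]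
      exact (aboveCount_congr (α := (Fin n)ᵒᵈ) (β := (Fin n)ᵒᵈ) hτg hi').trans (hgc i hi').2

theorem IsCompanion.wex_eq {σ τ : Equiv.Perm (Fin n)} (h : IsCompanion σ τ) : wex τ = wex σ :=
  congrArg Finset.card h.wexSet_eq

theorem IsCompanion.crossings_eq {σ τ : Equiv.Perm (Fin n)} (h : IsCompanion σ τ) :
    crossings τ = nestings σ := by
  simp only [crossings, nestings, h.upperCrossing, h.lowerCrossing]

theorem IsCompanion.nestings_eq {σ τ : Equiv.Perm (Fin n)} (h : IsCompanion σ τ) :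
    nestings τ = crossings σ :=
  h.symm.crossings_eq.symm

end PermCrossing

theorem mainTheorem9 (n k l m : ℕ) :
    (Finset.univ.filter fun σ : Equiv.Perm (Fin n) =>
        PermCrossing.wex σ = k ∧ PermCrossing.crossings σ = l ∧ PermCrossing.nestings σ = m).card =
      (Finset.univ.filter fun σ : Equiv.Perm (Fin n) =>
        PermCrossing.wex σ = k ∧ PermCrossing.nestings σ = l ∧
          PermCrossing.crossings σ = m).card := by
  choose φ hφ using PermCrossing.exists_isCompanion (n := n)
  -- Both `φ (φ σ)` and, by symmetry, `σ` are companions of `φ σ`.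
  have hinv : ∀ σ, φ (φ σ) = σ := fun σ => (hφ (φ σ)).eq (hφ σ).symm
  refine Finset.card_bij' (fun σ _ => φ σ) (fun σ _ => φ σ) ?_ ?_ (fun σ _ => hinv σ)
    (fun σ _ => hinv σ)
  all_goals
    intro σ hσ
    simpa only [Finset.mem_filter, Finset.mem_univ, true_and, (hφ σ).wex_eq,
      (hφ σ).crossings_eq, (hφ σ).nestings_eq] using hσ
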